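/- Let $R$ be a commutative ring with identity and let $C$ be a semidualizing $R$-module, i.e. $C$ has a projective resolution by finitely generated projective modules, the homothety map $R\to\operatorname{Hom}_R(C,C)$ is an isomorphism, and $\operatorname{Ext}_R^i(C,C)=0$ for all $i\ge 1$. An $R$-module is called $C$-projective (resp. $C$-flat) if it is isomorphic to $C\otimes_R P$ with $P$ projective (resp. to $C\otimes_R F$ with $F$ flat). A ($\mathbb Z$-indexed, possibly unbounded) complex $X$ of $R$-modules is called projective (resp. $C$-projective, $C$-flat) if $X$ is exact and every cycle module $Z_i(X)$, $i\in\mathbb Z$, is a projective (resp. $C$-projective, $C$-flat) module. A complex $X$ is called $D_C$-projective if there is an exact sequence of complexes $$\cdots\longrightarrow P_1\xrightarrow{f_1}P_0\xrightarrow{f_0}Q_{-1}\xrightarrow{f_{-1}}Q_{-2}\longrightarrow\cdots$$ with all $P_i$ projective complexes and all $Q_i$ $C$-projective complexes, which remains exact after applying $\operatorname{Hom}(-,H)$ (the group of morphisms of complexes) for every $C$-flat complex $H$, and such that $X\cong\operatorname{Im} f_0$. Then every projective complex of $R$-modules is $D_C$-projective, and every $C$-projective complex of $R$-modules is $D_C$-projective.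 -/

import Mathlib

open CategoryTheory
open scoped TensorProduct

universe u

/-- An `R`-module `C` over a commutative ring is semidualizing if it has a projective resolution by
finitely generated projective modules, the homothety map `R → Hom_R(C, C)`, `r ↦ (c ↦ r • c)`, is
bijective, and `Ext_R^i(C, C) = 0` for all `i ≥ 1`. -/
structure IsSemidualizing {R : Type u} [CommRing R] (C : ModuleCat.{u} R) : Prop where
  exists_finite_resolution :
    ∃ P : ProjectiveResolution C, ∀ n : ℕ, Module.Finite R (P.complex.X n)
  bijective_homothety : Function.Bijective (LinearMap.lsmul R C : R → (C →ₗ[R] C))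
  subsingleton_ext : ∀ i : ℕ, 1 ≤ i → Subsingleton (Abelian.Ext C C i)

/-- The class of projective `R`-modules. -/
def projectiveModules (R : Type u) [CommRing R] : ObjectProperty (ModuleCat.{u} R) :=
  fun M => Module.Projective R M

/-- The class of `C`-projective modules: the modules `C ⊗ P` with `P` projective, up to
isomorphism. -/
def cProjectiveModules {R : Type u} [CommRing R] (C : ModuleCat.{u} R) :
    ObjectProperty (ModuleCat.{u} R) :=
  fun M => ∃ P : ModuleCat.{u} R, Module.Projective R P ∧ Nonempty (M ≃ₗ[R] C ⊗[R] P)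

/-- The class of `C`-flat modules: the modules `C ⊗ F` with `F` flat, up to isomorphism. -/
def cFlatModules {R : Type u} [CommRing R] (C : ModuleCat.{u} R) :
    ObjectProperty (ModuleCat.{u} R) :=
  fun M => ∃ F : ModuleCat.{u} R, Module.Flat R F ∧ Nonempty (M ≃ₗ[R] C ⊗[R] F)

/-- For a class `𝒳` of modules, the class of `𝒳`-complexes: the exact (`ℤ`-indexed, possibly
unbounded) complexes all of whose cycle modules `Z_i` belong to `𝒳`. -/
def complexesOf {R : Type u} [CommRing R] (𝒳 : ObjectProperty (ModuleCat.{u} R)) :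
    ObjectProperty (ChainComplex (ModuleCat.{u} R) ℤ) :=
  fun X => X.Acyclic ∧ ∀ i : ℤ, 𝒳 (X.cycles i)

/-- A sequence `⋯ ⟶ T₁ ⟶ T₀ ⟶ T₋₁ ⟶ ⋯` in a preadditive category is `Hom(-, ℬ)`-exact if, for every
`B` in the class `ℬ`, the sequence
`⋯ ⟶ Hom(T₋₁, B) ⟶ Hom(T₀, B) ⟶ Hom(T₁, B) ⟶ ⋯` is exact. -/
def IsHomExact {𝒜 : Type*} [Category 𝒜] [Preadditive 𝒜] (ℬ : ObjectProperty 𝒜)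
    (T : ChainComplex 𝒜 ℤ) : Prop :=
  ∀ B : 𝒜, ℬ B → ∀ i : ℤ,
    Function.Exact (fun g : T.X (i - 1) ⟶ B => T.d i (i - 1) ≫ g)
      (fun g : T.X i ⟶ B => T.d (i + 1) i ≫ g)

/-- A complex `X` is `D_C`-projective if there is an exact sequence of complexes
`⋯ ⟶ T₁ ⟶ T₀ ⟶ T₋₁ ⟶ T₋₂ ⟶ ⋯` which is `Hom(-, H)`-exact for all `C`-flat complexes `H`, with `Tᵢ` a
projective complex for `i ≥ 0` and a `C`-projective complex for `i < 0`, such that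
`X ≅ Im (T₀ ⟶ T₋₁)`. The outer index of `T` is the position in the sequence; the objects `Tᵢ` are
complexes of modules themselves. -/
def IsDCProjective {R : Type u} [CommRing R] (C : ModuleCat.{u} R)
    (X : ChainComplex (ModuleCat.{u} R) ℤ) : Prop :=
  ∃ T : ChainComplex (ChainComplex (ModuleCat.{u} R) ℤ) ℤ,
    T.Acyclic ∧
    IsHomExact (complexesOf (cFlatModules C)) T ∧
    (∀ i : ℤ, 0 ≤ i → complexesOf (projectiveModules R) (T.X i)) ∧
    (∀ i : ℤ, i < 0 → complexesOf (cProjectiveModules C) (T.X i)) ∧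
    Nonempty (X ≅ Limits.image (T.d 0 (-1)))

/-!
If `P` is a resolution of `C` by finitely generated projective modules and `F` is flat, then
`Hom(Pₙ, C ⊗ F) ≅ Hom(Pₙ, C) ⊗ F`, so that `Extⁱ(C, C ⊗ F) = 0` for `i ≥ 1`, and `F ≅ Hom(C, C ⊗ F)`
and `Hom(Hom(Pₙ, C), C ⊗ F) ≅ Pₙ ⊗ F`. The first fact says that `⋯ ⟶ P₁ ⟶ P₀ ⟶ C ⟶ 0 ⟶ ⋯` makes the
module `C` `D_C`-projective, the last one that the coresolution
`0 ⟶ Hom(C, C) ⟶ Hom(P₀, C) ⟶ Hom(P₁, C) ⟶ ⋯` makes the module `R ≅ Hom(C, C)` `D_C`-projective.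
Tensoring with a projective module extends this to all projective and all `C`-projective modules.

Projective complexes and, since `Ext¹(C, C ⊗ F) = 0`, also `C`-projective complexes are
contractible, hence direct sums of disks on their cycles. Because
`Hom(⨁ Dₙ(Mₙ), H) = ∏ Hom(Mₙ, Hₙ)` and each term `Hₙ` of a `C`-flat complex is an extension of
`C`-flat modules, applying `⨁ Dₙ` to resolutions of the cycles gives a resolution of the complex.
-/

section LinearAlgebra

open Function LinearMap TensorProduct

variable {R : Type*} [CommRing R] {A B D M N F P Q : Type*}
  [AddCommGroup A] [Module R A] [AddCommGroup B] [Module R B] [AddCommGroup D] [Module R D]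
  [AddCommGroup M] [Module R M] [AddCommGroup N] [Module R N] [AddCommGroup F] [Module R F]
  [AddCommGroup P] [Module R P] [AddCommGroup Q] [Module R Q]

theorem bijective_of_retract {α β α' β' : Type*} {φ : α → β} {φ' : α' → β'} {i : α → α'}
    {r : α' → α} {j : β → β'} {s : β' → β} (hri : LeftInverse r i) (hsj : LeftInverse s j)
    (hij : ∀ a, j (φ a) = φ' (i a)) (hrs : ∀ a, s (φ' a) = φ (r a)) (h : Bijective φ') :
    Bijective φ := by
  refine ⟨fun a b hab => hri.injective (h.injective ?_), fun b => ?_⟩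
  · rw [← hij, ← hij, hab]
  · obtain ⟨a, ha⟩ := h.surjective (j b)
    exact ⟨r a, by rw [← hrs, ha, hsj]⟩

theorem rTensorHomToHomRTensor_comp_rTensor_lcomp (f : A →ₗ[R] B) :
    rTensorHomToHomRTensor (.id R) A M F ∘ₗ (lcomp R M f).rTensor F =
      lcomp R (M ⊗[R] F) f ∘ₗ rTensorHomToHomRTensor (.id R) B M F := by
  ext; simp

theorem rTensorHomToHomRTensor_bijective_of_projective [Module.Finite R P] [Module.Projective R P] :
    Bijective (rTensorHomToHomRTensor (.id R) P M F) := by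
  obtain ⟨n, f, g, -, -, hfg⟩ := Module.Finite.exists_comp_eq_id_of_projective R P
  have hgf : lcomp R M g ∘ₗ lcomp R M f = .id := by
    ext u x; simpa using congr(u ($hfg x))
  refine bijective_of_retract (φ' := rTensorHomToHomRTensor (.id R) (Fin n → R) M F)
    (i := (lcomp R M f).rTensor F) (r := (lcomp R M g).rTensor F)
    (j := lcomp R _ f) (s := lcomp R _ g) (fun x => ?_) (fun u => ?_)
    (fun x => congr($(rTensorHomToHomRTensor_comp_rTensor_lcomp f) x).symm)
    (fun x => congr($(rTensorHomToHomRTensor_comp_rTensor_lcomp g) x).symm) ?_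
  · rw [← LinearMap.comp_apply, ← rTensor_comp, hgf, rTensor_id, LinearMap.id_apply]
  · ext x; simpa using congr(u ($hfg x))
  · rw [← rTensorHomEquivHomRTensor_toLinearMap]
    exact (rTensorHomEquivHomRTensor R _ M F).bijective

theorem rTensorHomToHomRTensor_bijective_of_flat [Module.FinitePresentation R P] [Module.Flat R F] :
    Bijective (rTensorHomToHomRTensor (.id R) P M F) := by
  obtain ⟨n, m, p, f, hp, hfp⟩ := Module.FinitePresentation.exists_fin' R P
  exact bijective_of_bijective_of_injective_of_left_exact
    ((lcomp R M p).rTensor F) ((lcomp R M f).rTensor F) (lcomp R _ p) (lcomp R _ f)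
    _ (rTensorHomToHomRTensor (.id R) (Fin n → R) M F)
    (rTensorHomToHomRTensor (.id R) (Fin m → R) M F)
    (rTensorHomToHomRTensor_comp_rTensor_lcomp p).symm
    (rTensorHomToHomRTensor_comp_rTensor_lcomp f).symm
    (Module.Flat.rTensor_exact F (exact_lcomp_of_exact_of_surjective M hfp hp))
    (exact_lcomp_of_exact_of_surjective _ hfp hp)
    rTensorHomToHomRTensor_bijective_of_projective
    rTensorHomToHomRTensor_bijective_of_projective.injective
    (Module.Flat.rTensor_preserves_injective_linearMap _ (lcomp_injective_of_surjective p hp))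
    (lcomp_injective_of_surjective p hp)

theorem mk_flip_bijective_of_flat [Module.FinitePresentation R M] [Module.Flat R F]
    (hM : Bijective (lsmul R M : R → (M →ₗ[R] M))) :
    Bijective ((TensorProduct.mk R M F).flip) := by
  let e := LinearEquiv.ofBijective (lsmul R M : R →ₗ[R] M →ₗ[R] M) hM
  have comm : (TensorProduct.mk R M F).flip ∘ₗ (TensorProduct.lid R F).toLinearMap =
      rTensorHomToHomRTensor (.id R) M M F ∘ₗ (e.rTensor F).toLinearMap := by
    ext; simp [e]
  refine (Bijective.of_comp_iff _ (TensorProduct.lid R F).bijective).mp ?_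
  rw [← LinearEquiv.coe_coe (TensorProduct.lid R F), ← coe_comp, comm]
  exact rTensorHomToHomRTensor_bijective_of_flat.comp (e.rTensor F).bijective

/-- The natural map `p ⊗ x ↦ (φ ↦ φ p ⊗ x)`, which for `F = R` is the biduality map of `P`
with respect to `M`. -/
noncomputable def biduality (R M F P : Type*) [CommRing R] [AddCommGroup M] [Module R M]
    [AddCommGroup F] [Module R F] [AddCommGroup P] [Module R P] :
    P ⊗[R] F →ₗ[R] (P →ₗ[R] M) →ₗ[R] M ⊗[R] F :=
  rTensorHomToHomRTensor (.id R) (P →ₗ[R] M) M F ∘ₗ applyₗ.rTensor F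

@[simp]
theorem biduality_tmul (p : P) (x : F) (φ : P →ₗ[R] M) :
    biduality R M F P (p ⊗ₜ x) φ = φ p ⊗ₜ[R] x := rfl

theorem biduality_comp_rTensor (f : A →ₗ[R] B) :
    biduality R M F B ∘ₗ f.rTensor F = lcomp R _ (lcomp R M f) ∘ₗ biduality R M F A := by
  ext; simp

theorem biduality_bijective_of_projective [Module.Finite R P] [Module.Projective R P]
    (hM : Bijective (TensorProduct.mk R M F).flip) : Bijective (biduality R M F P) := by
  let dual : Module.Dual R P ⊗[R] M ≃ₗ[R] (P →ₗ[R] M) :=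
    LinearEquiv.ofBijective _ rTensorHomToHomRTensor_bijective_of_projective ≪≫ₗ
      (TensorProduct.lid R M).congrRight
  let e₁ : P ⊗[R] F ≃ₗ[R] (Module.Dual R P →ₗ[R] M →ₗ[R] M ⊗[R] F) :=
    (Module.evalEquiv R P).rTensor F ≪≫ₗ
      LinearEquiv.ofBijective _ rTensorHomToHomRTensor_bijective_of_projective ≪≫ₗ
      (TensorProduct.lid R F ≪≫ₗ LinearEquiv.ofBijective _ hM).congrRight
  let e₂ : ((P →ₗ[R] M) →ₗ[R] M ⊗[R] F) ≃ₗ[R] (Module.Dual R P →ₗ[R] M →ₗ[R] M ⊗[R] F) :=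
    dual.symm.congrLeft (M ⊗[R] F) R ≪≫ₗ
      (TensorProduct.lift.equiv (.id R) (Module.Dual R P) M (M ⊗[R] F)).symm
  have comm : e₂.toLinearMap ∘ₗ biduality R M F P = e₁.toLinearMap := by
    ext p x φ m
    simp [e₁, e₂, dual, LinearEquiv.congrRight, smul_tmul']
  refine (Bijective.of_comp_iff' e₂.bijective _).mp ?_
  rw [← LinearEquiv.coe_coe e₂, ← coe_comp, comm]
  exact e₁.bijective

theorem biduality_self_bijective (hM : Bijective (lsmul R M : R → (M →ₗ[R] M))) :
    Bijective (biduality R M F M) := by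
  let e := LinearEquiv.ofBijective (lsmul R M : R →ₗ[R] M →ₗ[R] M) hM
  let e' : ((M →ₗ[R] M) →ₗ[R] M ⊗[R] F) ≃ₗ[R] M ⊗[R] F :=
    e.symm.congrLeft (M ⊗[R] F) R ≪≫ₗ ringLmapEquivSelf R R _
  have comm : e'.toLinearMap ∘ₗ biduality R M F M = .id := by
    ext; simp [e, e']
  refine (Bijective.of_comp_iff' e'.bijective _).mp ?_
  rw [← LinearEquiv.coe_coe e', ← coe_comp, comm]
  exact bijective_id

theorem exact_lcomp_tensor [Module.Finite R A] [Module.Projective R A] [Module.Finite R B]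
    [Module.Projective R B] [Module.Finite R D] [Module.Projective R D] [Module.Flat R F]
    {f : A →ₗ[R] B} {g : B →ₗ[R] D} (h : Exact (lcomp R M g) (lcomp R M f)) :
    Exact (lcomp R (M ⊗[R] F) g) (lcomp R (M ⊗[R] F) f) :=
  Exact.of_ladder_linearEquiv_of_exact
    (e₁ := .ofBijective _ rTensorHomToHomRTensor_bijective_of_projective)
    (e₂ := .ofBijective _ rTensorHomToHomRTensor_bijective_of_projective)
    (e₃ := .ofBijective _ rTensorHomToHomRTensor_bijective_of_projective)
    (rTensorHomToHomRTensor_comp_rTensor_lcomp g).symm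
    (rTensorHomToHomRTensor_comp_rTensor_lcomp f).symm (Module.Flat.rTensor_exact F h)

theorem exact_lcomp_lcomp_of_biduality_bijective [Module.Flat R F]
    (hA : Bijective (biduality R M F A)) (hB : Bijective (biduality R M F B))
    (hD : Bijective (biduality R M F D))
    {f : A →ₗ[R] B} {g : B →ₗ[R] D} (h : Exact f g) :
    Exact (lcomp R (M ⊗[R] F) (lcomp R M f)) (lcomp R (M ⊗[R] F) (lcomp R M g)) :=
  Exact.of_ladder_linearEquiv_of_exact (e₁ := .ofBijective _ hA) (e₂ := .ofBijective _ hB)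
    (e₃ := .ofBijective _ hD) (biduality_comp_rTensor f).symm (biduality_comp_rTensor g).symm
    (Module.Flat.rTensor_exact F h)

theorem lcomp_lcomp_surjective_of_biduality_surjective (hB : Surjective (biduality R M F B))
    {f : A →ₗ[R] B} (hf : Surjective f) : Surjective (lcomp R (M ⊗[R] F) (lcomp R M f)) := by
  refine Surjective.of_comp (g := biduality R M F A) ?_
  rw [← coe_comp, ← biduality_comp_rTensor, coe_comp]
  exact hB.comp (rTensor_surjective F hf)

theorem exact_compRight_of_projective [Module.Projective R Q] {f : A →ₗ[R] B} {g : B →ₗ[R] D}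
    (h : Exact f g) : Exact (f.compRight R : (Q →ₗ[R] A) →ₗ[R] _) (g.compRight R) := by
  intro u
  refine ⟨fun hu => ?_, ?_⟩
  · have hu' (x : Q) : u x ∈ range f := (h _).mp congr($hu x)
    obtain ⟨v, hv⟩ := Module.projective_lifting_property f.rangeRestrict (u.codRestrict _ hu')
      f.surjective_rangeRestrict
    exact ⟨v, LinearMap.ext fun x => congr(($hv x : B))⟩
  · rintro ⟨v, rfl⟩
    ext x
    exact h.apply_apply_eq_zero (v x)

theorem exact_lcomp_lTensor [Module.Projective R Q] {f : A →ₗ[R] B} {g : B →ₗ[R] D}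
    (h : Exact (lcomp R N g) (lcomp R N f)) :
    Exact (lcomp R N (g.lTensor Q)) (lcomp R N (f.lTensor Q)) := by
  refine Exact.of_ladder_linearEquiv_of_exact (e₁ := TensorProduct.lift.equiv (.id R) Q D N)
    (e₂ := TensorProduct.lift.equiv (.id R) Q B N) (e₃ := TensorProduct.lift.equiv (.id R) Q A N)
    ?_ ?_ (exact_compRight_of_projective h)
  all_goals
    ext
    simp

theorem compRight_tensor_surjective [Module.Projective R Q] {q : A →ₗ[R] B}
    (h : Surjective (q.compRight R : (M →ₗ[R] A) →ₗ[R] _)) :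
    Surjective (q.compRight R : (M ⊗[R] Q →ₗ[R] A) →ₗ[R] _) := by
  intro u
  obtain ⟨v, hv⟩ := Module.projective_lifting_property _ (TensorProduct.mk R M Q |>.flip.compr₂ u) h
  refine ⟨TensorProduct.lift v.flip, TensorProduct.ext' fun m x => ?_⟩
  simpa using congr($hv x m)

end LinearAlgebra

section HomExact

open Limits

variable {𝒜 : Type*} [Category* 𝒜]

/-- The sequence obtained by applying `Hom(-, H)` to the short complex `S` is exact. -/
def HomExact [Preadditive 𝒜] (S : ShortComplex 𝒜) (H : 𝒜) : Prop :=
  ∀ u : S.X₂ ⟶ H, S.f ≫ u = 0 → ∃ v : S.X₃ ⟶ H, S.g ≫ v = u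

theorem HomExact.of_iso [Preadditive 𝒜] {S : ShortComplex 𝒜} {H H' : 𝒜} (h : HomExact S H)
    (e : H ≅ H') : HomExact S H' := by
  intro u hu
  obtain ⟨v, hv⟩ := h (u ≫ e.inv) (by rw [reassoc_of% hu, zero_comp])
  exact ⟨v ≫ e.hom, by rw [reassoc_of% hv, e.inv_hom_id, Category.comp_id]⟩

theorem isHomExact_iff [Preadditive 𝒜] {ℬ : ObjectProperty 𝒜} {T : ChainComplex 𝒜 ℤ} :
    IsHomExact ℬ T ↔ ∀ B, ℬ B → ∀ j, HomExact (T.sc' (j + 1 + 1) (j + 1) j) B := by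
  have exact_iff (B : 𝒜) (i j : ℤ) (hj : i - 1 = j) :
      Function.Exact (fun g : T.X (i - 1) ⟶ B => T.d i (i - 1) ≫ g)
        (fun g : T.X i ⟶ B => T.d (i + 1) i ≫ g) ↔ HomExact (T.sc' (i + 1) i j) B := by
    subst hj
    refine ⟨fun h u hu => (h u).mp hu, fun h u => ⟨h u, ?_⟩⟩
    rintro ⟨v, rfl⟩
    simp
  refine ⟨fun h B hB j => (exact_iff B (j + 1) j (by lia)).mp (h B hB _), fun h B hB i => ?_⟩
  obtain ⟨j, rfl⟩ : ∃ j, i = j + 1 := ⟨i - 1, by lia⟩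
  exact (exact_iff B (j + 1) j (by lia)).mpr (h B hB j)

variable [Abelian 𝒜]

theorem acyclic_iff_exact_sc' (X : ChainComplex 𝒜 ℤ) :
    X.Acyclic ↔ ∀ j : ℤ, (X.sc' (j + 1 + 1) (j + 1) j).Exact := by
  have exactAt_iff (j : ℤ) : X.ExactAt (j + 1) ↔ (X.sc' (j + 1 + 1) (j + 1) j).Exact :=
    X.exactAt_iff' _ _ _ (by simp) (by simp)
  refine ⟨fun h j => (exactAt_iff j).mp (h _), fun h i => ?_⟩
  obtain ⟨j, rfl⟩ : ∃ j, i = j + 1 := ⟨i - 1, by lia⟩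
  exact (exactAt_iff j).mpr (h j)

theorem exact_comp_of_mono {X Y Z W : 𝒜} {f : X ⟶ Y} {g : Y ⟶ Z} {w : f ≫ g = 0}
    (h : (ShortComplex.mk f g w).Exact) (m : Z ⟶ W) [Mono m] :
    (ShortComplex.mk f (g ≫ m) (by rw [reassoc_of% w, zero_comp])).Exact := by
  let φ : ShortComplex.mk f g w ⟶ .mk f (g ≫ m) (by rw [reassoc_of% w, zero_comp]) :=
    { τ₁ := 𝟙 X, τ₂ := 𝟙 Y, τ₃ := m }
  have : IsIso φ.τ₂ := inferInstanceAs (IsIso (𝟙 Y))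
  have : Epi φ.τ₁ := inferInstanceAs (Epi (𝟙 X))
  have : Mono φ.τ₃ := ‹Mono m›
  exact (ShortComplex.exact_iff_of_epi_of_isIso_of_mono φ).mp h

theorem exact_comp_of_epi {W X Y Z : 𝒜} {f : X ⟶ Y} {g : Y ⟶ Z} {w : f ≫ g = 0}
    (e : W ⟶ X) [Epi e] (h : (ShortComplex.mk f g w).Exact) :
    (ShortComplex.mk (e ≫ f) g (by rw [Category.assoc, w, comp_zero])).Exact := by
  let φ : ShortComplex.mk (e ≫ f) g (by rw [Category.assoc, w, comp_zero]) ⟶ .mk f g w :=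
    { τ₁ := e, τ₂ := 𝟙 Y, τ₃ := 𝟙 Z }
  have : IsIso φ.τ₂ := inferInstanceAs (IsIso (𝟙 Y))
  have : Epi φ.τ₁ := ‹Epi e›
  have : Mono φ.τ₃ := inferInstanceAs (Mono (𝟙 Z))
  exact (ShortComplex.exact_iff_of_epi_of_isIso_of_mono φ).mpr h

theorem HomExact.of_shortExact {S T : ShortComplex 𝒜} (hS : S.ShortExact)
    (h₁ : HomExact T S.X₁) (h₃ : HomExact T S.X₃)
    (exists_lift : ∀ v : T.X₃ ⟶ S.X₃, ∃ w, w ≫ S.g = v) : HomExact T S.X₂ := by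
  have := hS.mono_f
  intro u hu
  obtain ⟨v, hv⟩ := h₃ (u ≫ S.g) (by rw [reassoc_of% hu, zero_comp])
  obtain ⟨w, rfl⟩ := exists_lift v
  have hg : (u - T.g ≫ w) ≫ S.g = 0 := by
    rw [Preadditive.sub_comp, Category.assoc, hv, sub_self]
  obtain ⟨t, ht⟩ := h₁ (hS.exact.lift _ hg) (by
    rw [← cancel_mono S.f, Category.assoc, hS.exact.lift_f, Preadditive.comp_sub, hu, T.zero_assoc]
    simp)
  refine ⟨t ≫ S.f + w, ?_⟩
  rw [Preadditive.comp_add, reassoc_of% ht, hS.exact.lift_f, sub_add_cancel]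

theorem nonempty_iso_image_iff {X Y I : 𝒜} {f : X ⟶ Y} :
    Nonempty (I ≅ image f) ↔ ∃ (e : X ⟶ I) (m : I ⟶ Y), Epi e ∧ Mono m ∧ e ≫ m = f := by
  constructor
  · rintro ⟨φ⟩
    exact ⟨factorThruImage f ≫ φ.inv, φ.hom ≫ image.ι f, inferInstance, inferInstance, by simp⟩
  · rintro ⟨e, m, he, hm, h⟩
    have := strongEpi_of_epi e
    exact ⟨image.isoStrongEpiMono e m h⟩

variable [HasExt 𝒜]

open Abelian in
theorem subsingleton_ext_succ_iff_homExact {X : 𝒜} (P : ProjectiveResolution X) (Y : 𝒜) (n : ℕ) :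
    Subsingleton (Ext X Y (n + 1)) ↔ HomExact (P.complex.sc' (n + 2) (n + 1) n) Y := by
  refine ⟨fun _ u hu => ?_, fun h => subsingleton_of_forall_eq 0 fun α => ?_⟩
  · exact (P.extMk_eq_zero_iff u (n + 2) rfl hu n rfl).mp (Subsingleton.elim _ _)
  · obtain ⟨u, hu, rfl⟩ := P.extMk_surjective α (n + 2) rfl
    exact (P.extMk_eq_zero_iff u (n + 2) rfl hu n rfl).mpr (h u hu)

theorem exists_lift_of_subsingleton_ext_one {S : ShortComplex 𝒜} (hS : S.ShortExact) (A : 𝒜)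
    [Subsingleton (Abelian.Ext A S.X₁ 1)] (u : A ⟶ S.X₃) : ∃ v, v ≫ S.g = u := by
  obtain ⟨α, hα⟩ := Abelian.Ext.covariant_sequence_exact₃ A hS (Abelian.Ext.mk₀ u) (zero_add 1)
    (Subsingleton.elim _ _)
  obtain ⟨v, rfl⟩ := (Abelian.Ext.mk₀_bijective A S.X₂).surjective α
  exact ⟨v, (Abelian.Ext.mk₀_bijective A S.X₃).injective (by simpa using hα)⟩

end HomExact

section Splice

open Limits

variable {𝒜 : Type*} [Category* 𝒜]

section Preadditive

variable [Preadditive 𝒜] (K : ChainComplex 𝒜 ℕ) (L : CochainComplex 𝒜 ℕ) (f : K.X 0 ⟶ L.X 0)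

/-- The terms of `splice`. -/
def spliceX : ℤ → 𝒜
  | .ofNat n => K.X n
  | .negSucc n => L.X n

/-- The differentials of `splice`. -/
def spliceD : ∀ i j, spliceX K L i ⟶ spliceX K L j
  | .ofNat m, .ofNat n => K.d m n
  | .ofNat 0, .negSucc 0 => f
  | .negSucc m, .negSucc n => L.d m n
  | .ofNat _, .negSucc _ => 0
  | .negSucc _, .ofNat _ => 0

variable {K L f}

/-- The complex `⋯ ⟶ K₁ ⟶ K₀ ⟶ L⁰ ⟶ L¹ ⟶ ⋯` with `K₀` in degree `0` and `L⁰` in degree `-1`. -/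
def splice (hK : K.d 1 0 ≫ f = 0) (hL : f ≫ L.d 0 1 = 0) : ChainComplex 𝒜 ℤ where
  X := spliceX K L
  d := spliceD K L f
  shape := by
    rintro (m | m) (n | n) h
    · exact K.shape m n fun hmn => h (congrArg Int.ofNat hmn)
    · rcases m with _ | m <;> rcases n with _ | n <;> first | rfl | exact absurd rfl h
    · cases m <;> rfl
    · exact L.shape m n fun hmn => h (by subst hmn; rfl)
  d_comp_d' := by
    rintro i j k rfl rfl
    rcases k with n | _ | _ | n
    · exact K.d_comp_d _ _ _
    · exact hK
    · exact hL
    · exact L.d_comp_d _ _ _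

variable {hK : K.d 1 0 ≫ f = 0} {hL : f ≫ L.d 0 1 = 0}

theorem forall_splice_sc' {p : ShortComplex 𝒜 → Prop}
    (h₁ : ∀ n, p (K.sc' (n + 2) (n + 1) n)) (h₂ : p (.mk (K.d 1 0) f hK))
    (h₃ : p (.mk f (L.d 0 1) hL)) (h₄ : ∀ n, p (L.sc' n (n + 1) (n + 2))) :
    ∀ j, p ((splice hK hL).sc' (j + 1 + 1) (j + 1) j)
  | .ofNat n => h₁ n
  | .negSucc 0 => h₂
  | .negSucc 1 => h₃
  | .negSucc (n + 2) => h₄ n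

end Preadditive

variable [Abelian 𝒜] {𝒱 𝒲 ℬ : ObjectProperty 𝒜} {X : 𝒜}

/-- The pattern of `IsDCProjective` in an arbitrary abelian category: `X ≅ Im (T₀ ⟶ T₋₁)` for an
exact and `Hom(-, ℬ)`-exact sequence `⋯ ⟶ T₁ ⟶ T₀ ⟶ T₋₁ ⟶ T₋₂ ⟶ ⋯` with `Tᵢ` in `𝒱` for `i ≥ 0` and
in `𝒲` for `i < 0`. -/
def HasCompleteResolution (𝒱 𝒲 ℬ : ObjectProperty 𝒜) (X : 𝒜) : Prop :=
  ∃ T : ChainComplex 𝒜 ℤ, T.Acyclic ∧ IsHomExact ℬ T ∧ (∀ i : ℤ, 0 ≤ i → 𝒱 (T.X i)) ∧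
    (∀ i : ℤ, i < 0 → 𝒲 (T.X i)) ∧ Nonempty (X ≅ image (T.d 0 (-1)))

theorem HasCompleteResolution.of_iso {Y : 𝒜} (h : HasCompleteResolution 𝒱 𝒲 ℬ X) (e : X ≅ Y) :
    HasCompleteResolution 𝒱 𝒲 ℬ Y := by
  obtain ⟨T, acyclic, homExact, hP, hQ, ⟨e'⟩⟩ := h
  exact ⟨T, acyclic, homExact, hP, hQ, ⟨e.symm ≪≫ e'⟩⟩

/-- The augmentation `P₀ ⟶ X` of a projective resolution `P` of `X`. -/
noncomputable def augmentation (P : ProjectiveResolution X) : P.complex.X 0 ⟶ X :=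
  P.π.f 0

instance epi_augmentation (P : ProjectiveResolution X) : Epi (augmentation P) :=
  inferInstanceAs (Epi (P.π.f 0))

theorem d_comp_augmentation (P : ProjectiveResolution X) :
    P.complex.d 1 0 ≫ augmentation P = 0 :=
  P.complex_d_comp_π_f_zero

theorem exact_augmentation (P : ProjectiveResolution X) :
    (ShortComplex.mk _ _ (d_comp_augmentation P)).Exact :=
  P.exact₀

/-- A coresolution `0 ⟶ X ⟶ L⁰ ⟶ L¹ ⟶ ⋯` by objects of `𝒲` that is exact and `Hom(-, ℬ)`-exact. -/
structure ProperCoresolution (𝒲 ℬ : ObjectProperty 𝒜) (X : 𝒜) where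
  complex : CochainComplex 𝒜 ℕ
  ι : X ⟶ complex.X 0
  mono_ι : Mono ι
  ι_d : ι ≫ complex.d 0 1 = 0
  prop_X : ∀ n, 𝒲 (complex.X n)
  exact_zero : (ShortComplex.mk ι (complex.d 0 1) ι_d).Exact
  exact_succ : ∀ n, (complex.sc' n (n + 1) (n + 2)).Exact
  exists_extension : ∀ B, ℬ B → ∀ u : X ⟶ B, ∃ v, ι ≫ v = u
  homExact_zero : ∀ B, ℬ B → HomExact (.mk ι (complex.d 0 1) ι_d) B
  homExact_succ : ∀ B, ℬ B → ∀ n, HomExact (complex.sc' n (n + 1) (n + 2)) B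

namespace ProperCoresolution

open ZeroObject

theorem isZero_single₀_X_succ (X : 𝒜) (n : ℕ) :
    IsZero (((CochainComplex.single₀ 𝒜).obj X).X (n + 1)) :=
  HomologicalComplex.isZero_single_obj_X _ _ _ _ n.succ_ne_zero

/-- The coresolution `0 ⟶ X ⟶ X ⟶ 0 ⟶ ⋯`. -/
noncomputable def self (hX : 𝒲 X) (h₀ : 𝒲 0) [𝒲.IsClosedUnderIsomorphisms] :
    ProperCoresolution 𝒲 ℬ X where
  complex := (CochainComplex.single₀ 𝒜).obj X
  ι := 𝟙 X
  mono_ι := inferInstanceAs (Mono (𝟙 X))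
  ι_d := comp_zero
  prop_X
    | 0 => hX
    | n + 1 => 𝒲.prop_of_iso (isZero_single₀_X_succ X n).isoZero.symm h₀
  exact_zero := (ShortComplex.exact_iff_epi _ rfl).mpr (inferInstanceAs (Epi (𝟙 X)))
  exact_succ n := ShortComplex.exact_of_isZero_X₂ _ (isZero_single₀_X_succ X n)
  exists_extension _ _ u := ⟨u, Category.id_comp u⟩
  homExact_zero _ _ u hu := ⟨0, comp_zero.trans (hu.symm.trans (Category.id_comp u))⟩
  homExact_succ _ _ n _ _ := ⟨0, (isZero_single₀_X_succ X n).eq_of_src _ _⟩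

variable (L : ProperCoresolution 𝒲 ℬ X) (P : ProjectiveResolution X)

/-- The sequence `⋯ ⟶ P₁ ⟶ P₀ ⟶ L⁰ ⟶ L¹ ⟶ ⋯` through `X`, for a projective resolution `P` and a
proper coresolution `L` of `X`. -/
noncomputable def completeResolution : ChainComplex 𝒜 ℤ :=
  splice (K := P.complex) (L := L.complex) (f := augmentation P ≫ L.ι)
    (by rw [reassoc_of% d_comp_augmentation P, zero_comp])
    (by rw [Category.assoc, L.ι_d, comp_zero])

theorem completeResolution_acyclic : (L.completeResolution P).Acyclic := by
  refine (acyclic_iff_exact_sc' _).mpr (forall_splice_sc' P.exact_succ ?_ ?_ L.exact_succ)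
  · have := L.mono_ι
    exact exact_comp_of_mono (exact_augmentation P) L.ι
  · exact exact_comp_of_epi (augmentation P) L.exact_zero

theorem completeResolution_isHomExact [HasExt 𝒜]
    (hext : ∀ B, ℬ B → ∀ n, Subsingleton (Abelian.Ext X B (n + 1))) :
    IsHomExact ℬ (L.completeResolution P) := by
  refine isHomExact_iff.mpr fun B hB => forall_splice_sc' (p := (HomExact · B))
    (fun n => (subsingleton_ext_succ_iff_homExact P B n).mp (hext B hB n))
    (fun u hu => ?_) (fun u hu => ?_) (L.homExact_succ B hB)
  · have exact₀ := exact_augmentation P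
    obtain ⟨v, hv⟩ := L.exists_extension B hB (exact₀.desc u hu)
    exact ⟨v, by rw [Category.assoc, hv, exact₀.g_desc]⟩
  · refine L.homExact_zero B hB u ((cancel_epi (augmentation P)).mp ?_)
    rw [comp_zero, ← Category.assoc, hu]

include L in
theorem hasCompleteResolution [HasExt 𝒜] (hP : ∀ n, 𝒱 (P.complex.X n))
    (hext : ∀ B, ℬ B → ∀ n, Subsingleton (Abelian.Ext X B (n + 1))) :
    HasCompleteResolution 𝒱 𝒲 ℬ X := by
  refine ⟨L.completeResolution P, L.completeResolution_acyclic P,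
    L.completeResolution_isHomExact P hext, ?_, ?_,
    nonempty_iso_image_iff.mpr ⟨augmentation P, L.ι, epi_augmentation P, L.mono_ι, rfl⟩⟩
  · rintro (n | n) hn
    exacts [hP n, absurd hn (by lia)]
  · rintro (n | n) hn
    exacts [absurd hn (by simp), L.prop_X n]

end ProperCoresolution

end Splice

section Module

open Function LinearMap

variable {R : Type u} [CommRing R] {C : ModuleCat.{u} R}

theorem homExact_iff_exact_lcomp {S : ShortComplex (ModuleCat.{u} R)} {H : ModuleCat.{u} R} :
    HomExact S H ↔ Exact (lcomp R H S.g.hom) (lcomp R H S.f.hom) := by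
  refine ⟨fun h u => ⟨fun hu => ?_, ?_⟩, fun h u hu => ?_⟩
  · obtain ⟨v, hv⟩ := h (ModuleCat.ofHom u) (ModuleCat.hom_ext hu)
    exact ⟨v.hom, congr(ModuleCat.Hom.hom $hv)⟩
  · rintro ⟨v, rfl⟩
    exact LinearMap.ext fun x => by simp
  · obtain ⟨v, hv⟩ := (h u.hom).mp congr(ModuleCat.Hom.hom $hu)
    exact ⟨ModuleCat.ofHom v, ModuleCat.hom_ext hv⟩

theorem exact_iff_function_exact {S : ShortComplex (ModuleCat.{u} R)} :
    S.Exact ↔ Exact S.f.hom S.g.hom :=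
  ShortComplex.ShortExact.moduleCat_exact_iff_function_exact S

instance : (projectiveModules R).IsClosedUnderIsomorphisms where
  of_iso e (_ : Module.Projective R _) := Module.Projective.of_equiv e.toLinearEquiv

instance : (cProjectiveModules C).IsClosedUnderIsomorphisms where
  of_iso e h := by
    obtain ⟨P, hP, ⟨e'⟩⟩ := h
    exact ⟨P, hP, ⟨e.symm.toLinearEquiv ≪≫ₗ e'⟩⟩

theorem cProjectiveModules_le_cFlatModules : cProjectiveModules C ≤ cFlatModules C := by
  rintro M ⟨P, hP, e⟩
  exact ⟨P, inferInstance, e⟩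

open ZeroObject in
theorem cProjectiveModules_zero : cProjectiveModules C (0 : ModuleCat.{u} R) := by
  have : Subsingleton (0 : ModuleCat.{u} R) :=
    ModuleCat.subsingleton_of_isZero (Limits.isZero_zero _)
  exact ⟨0, inferInstance, ⟨0⟩⟩

theorem cProjectiveModules_hom (P : Type u) [AddCommGroup P] [Module R P] [Module.Finite R P]
    [Module.Projective R P] : cProjectiveModules C (.of R (P →ₗ[R] C)) := by
  let e : Module.Dual R P ⊗[R] C ≃ₗ[R] (P →ₗ[R] C) :=
    .ofBijective _ rTensorHomToHomRTensor_bijective_of_projective ≪≫ₗ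
      (TensorProduct.lid R C).congrRight
  exact ⟨.of R (Module.Dual R P), inferInstanceAs (Module.Projective R (Module.Dual R P)),
    ⟨e.symm ≪≫ₗ TensorProduct.comm R _ _⟩⟩

instance {M : ModuleCat.{u} R} (P : ProjectiveResolution M) (n : ℕ) :
    Module.Projective R (P.complex.X n) :=
  (IsProjective.iff_projective _).mpr (P.projective n)

theorem augmentation_surjective {M : ModuleCat.{u} R} (P : ProjectiveResolution M) :
    Surjective (augmentation P).hom :=
  (ModuleCat.epi_iff_surjective _).mp inferInstance

/-- `D_C`-projectivity of modules: the analogue of `IsDCProjective` with modules in place of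
complexes. -/
abbrev IsDCProjectiveModule (C M : ModuleCat.{u} R) : Prop :=
  HasCompleteResolution (projectiveModules R) (cProjectiveModules C) (cFlatModules C) M

/-- The cochain complex `Hom(K, N)`. -/
def homComplex (K : ChainComplex (ModuleCat.{u} R) ℕ) (N : ModuleCat.{u} R) :
    CochainComplex (ModuleCat.{u} R) ℕ where
  X n := .of R (K.X n →ₗ[R] N)
  d m n := ModuleCat.ofHom (lcomp R N (K.d n m).hom)
  shape m n h := by
    ext u x
    simp [K.shape n m h]
  d_comp_d' := by
    intro i j k _ _
    ext u x
    simp [← ModuleCat.comp_apply]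

namespace IsSemidualizing

variable (hC : IsSemidualizing C)

/-- A projective resolution of the semidualizing module `C` by finitely generated modules. -/
noncomputable def resolution : ProjectiveResolution C :=
  hC.exists_finite_resolution.choose

instance (n : ℕ) : Module.Finite R (hC.resolution.complex.X n) :=
  hC.exists_finite_resolution.choose_spec n

include hC in
theorem finitePresentation : Module.FinitePresentation R C := by
  have exact := exact_iff_function_exact.mp (exact_augmentation hC.resolution)
  have := Module.finitePresentation_of_projective R (hC.resolution.complex.X 0)
  refine Module.finitePresentation_of_surjective _ (augmentation_surjective hC.resolution) ?_
  rw [exact.linearMap_ker_eq]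
  exact Module.Finite.iff_fg.mp (Module.Finite.range (hC.resolution.complex.d 1 0).hom)

theorem exact_lcomp_resolution (n : ℕ) :
    Exact (lcomp R C (hC.resolution.complex.d (n + 1) n).hom)
      (lcomp R C (hC.resolution.complex.d (n + 2) (n + 1)).hom) :=
  homExact_iff_exact_lcomp.mp ((subsingleton_ext_succ_iff_homExact _ C n).mp
    (hC.subsingleton_ext (n + 1) n.succ_pos))

include hC in
theorem subsingleton_ext_cFlat {H : ModuleCat.{u} R} (hH : cFlatModules C H) (n : ℕ) :
    Subsingleton (Abelian.Ext C H (n + 1)) := by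
  obtain ⟨F, hF, ⟨e⟩⟩ := hH
  have exact := exact_lcomp_tensor (F := F) (hC.exact_lcomp_resolution n)
  exact (subsingleton_ext_succ_iff_homExact hC.resolution H n).mpr
    (HomExact.of_iso (H := .of R (C ⊗[R] F)) (homExact_iff_exact_lcomp.mpr exact)
      e.symm.toModuleIso)

include hC in
theorem isDCProjectiveModule_self : IsDCProjectiveModule C C := by
  have hCC : cProjectiveModules C C :=
    ⟨.of R R, inferInstanceAs (Module.Projective R R), ⟨(TensorProduct.rid R C).symm⟩⟩
  exact (ProperCoresolution.self hCC cProjectiveModules_zero).hasCompleteResolution hC.resolution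
    (fun n => inferInstanceAs (Module.Projective R _)) fun H hH => hC.subsingleton_ext_cFlat hH

theorem biduality_resolution_bijective (F : Type u) [AddCommGroup F] [Module R F] [Module.Flat R F]
    (n : ℕ) : Bijective (biduality R C F (hC.resolution.complex.X n)) :=
  have := hC.finitePresentation
  biduality_bijective_of_projective (mk_flip_bijective_of_flat hC.bijective_homothety)

/-- The coresolution `0 ⟶ Hom(C, C) ⟶ Hom(P₀, C) ⟶ Hom(P₁, C) ⟶ ⋯` obtained from a resolution `P`
of `C`. -/
noncomputable def endCoresolution :
    ProperCoresolution (cProjectiveModules C) (cFlatModules C) (.of R (C →ₗ[R] C)) where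
  complex := homComplex hC.resolution.complex C
  ι := ModuleCat.ofHom (lcomp R C (augmentation hC.resolution).hom)
  mono_ι := (ModuleCat.mono_iff_injective _).mpr
    (lcomp_injective_of_surjective _ (augmentation_surjective _))
  ι_d := by
    ext u
    exact LinearMap.ext fun x =>
      congr(u (ModuleCat.Hom.hom $(d_comp_augmentation hC.resolution) x)).trans (map_zero u)
  prop_X n := cProjectiveModules_hom _
  exact_zero := exact_iff_function_exact.mpr (exact_lcomp_of_exact_of_surjective _
    (exact_iff_function_exact.mp (exact_augmentation _)) (augmentation_surjective _))
  exact_succ n := exact_iff_function_exact.mpr (hC.exact_lcomp_resolution n)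
  exists_extension H hH u := by
    obtain ⟨F, -, ⟨e⟩⟩ := hH
    obtain ⟨v, hv⟩ := lcomp_lcomp_surjective_of_biduality_surjective
      (biduality_self_bijective hC.bijective_homothety).surjective
      (augmentation_surjective hC.resolution) (e.toLinearMap ∘ₗ u.hom)
    refine ⟨ModuleCat.ofHom (e.symm.toLinearMap ∘ₗ v), ModuleCat.hom_ext ?_⟩
    exact LinearMap.ext fun φ => e.symm_apply_eq.mpr congr($hv φ)
  homExact_zero H hH := by
    obtain ⟨F, hF, ⟨e⟩⟩ := hH
    refine HomExact.of_iso (homExact_iff_exact_lcomp.mpr ?_) e.symm.toModuleIso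
    exact exact_lcomp_lcomp_of_biduality_bijective (hC.biduality_resolution_bijective F 1)
      (hC.biduality_resolution_bijective F 0) (biduality_self_bijective hC.bijective_homothety)
      (exact_iff_function_exact.mp (exact_augmentation hC.resolution))
  homExact_succ H hH n := by
    obtain ⟨F, hF, ⟨e⟩⟩ := hH
    refine HomExact.of_iso (homExact_iff_exact_lcomp.mpr ?_) e.symm.toModuleIso
    exact exact_lcomp_lcomp_of_biduality_bijective (hC.biduality_resolution_bijective F (n + 2))
      (hC.biduality_resolution_bijective F (n + 1)) (hC.biduality_resolution_bijective F n)
      (exact_iff_function_exact.mp (hC.resolution.exact_succ n))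

include hC in
theorem isDCProjectiveModule_end : IsDCProjectiveModule C (.of R (C →ₗ[R] C)) := by
  have : Module.Projective R (C →ₗ[R] C) :=
    .of_equiv (.ofBijective (lsmul R C : R →ₗ[R] C →ₗ[R] C) hC.bijective_homothety)
  have : Projective (ModuleCat.of R (C →ₗ[R] C)) := (IsProjective.iff_projective _).mp this
  exact hC.endCoresolution.hasCompleteResolution (.self _)
    (fun n => inferInstanceAs (Module.Projective R _))
    fun H _ n => Abelian.Ext.subsingleton_of_projective _ _ _

include hC in
theorem exists_lift_of_cProjective {S : ShortComplex (ModuleCat.{u} R)} (hS : S.ShortExact)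
    (h₁ : cFlatModules C S.X₁) {A : ModuleCat.{u} R} (hA : cProjectiveModules C A)
    (u : A ⟶ S.X₃) : ∃ v, v ≫ S.g = u := by
  obtain ⟨P, hP, ⟨e⟩⟩ := hA
  have := hC.subsingleton_ext_cFlat h₁ 0
  have surjective : Surjective (S.g.hom.compRight R : (C →ₗ[R] S.X₂) →ₗ[R] _) := fun φ =>
    (exists_lift_of_subsingleton_ext_one hS C (ModuleCat.ofHom φ)).imp' ModuleCat.Hom.hom
      fun _ h => congr(ModuleCat.Hom.hom $h)
  obtain ⟨v, hv⟩ := compRight_tensor_surjective (Q := P) surjective (u.hom ∘ₗ e.symm.toLinearMap)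
  refine ⟨ModuleCat.ofHom (v ∘ₗ e.toLinearMap), ModuleCat.hom_ext (LinearMap.ext fun a => ?_)⟩
  simpa using congr($hv (e a))

end IsSemidualizing

open MonoidalCategory in
theorem HasCompleteResolution.tensorLeft (Q : ModuleCat.{u} R) [Module.Projective R Q]
    {ℬ : ObjectProperty (ModuleCat.{u} R)} {M : ModuleCat.{u} R}
    (h : HasCompleteResolution (projectiveModules R) (cProjectiveModules C) ℬ M) :
    HasCompleteResolution (projectiveModules R) (cProjectiveModules C) ℬ (Q ⊗ M) := by
  obtain ⟨T, acyclic, homExact, hP, hQ, image⟩ := h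
  refine ⟨((MonoidalCategory.tensorLeft Q).mapHomologicalComplex _).obj T,
    (acyclic_iff_exact_sc' _).mpr fun j => exact_iff_function_exact.mpr ?_,
    isHomExact_iff.mpr fun B hB j => homExact_iff_exact_lcomp.mpr ?_, fun i hi => ?_,
    fun i hi => ?_, ?_⟩
  · exact Module.Flat.lTensor_exact Q
      (exact_iff_function_exact.mp ((acyclic_iff_exact_sc' T).mp acyclic j))
  · exact exact_lcomp_lTensor (homExact_iff_exact_lcomp.mp (isHomExact_iff.mp homExact B hB j))
  · have : Module.Projective R (T.X i) := hP i hi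
    exact inferInstanceAs (Module.Projective R (Q ⊗[R] T.X i))
  · obtain ⟨P, hP, ⟨e⟩⟩ := hQ i hi
    exact ⟨.of R (Q ⊗[R] P), inferInstanceAs (Module.Projective R (Q ⊗[R] P)),
      ⟨e.lTensor Q ≪≫ₗ TensorProduct.leftComm R Q C P⟩⟩
  · obtain ⟨e, m, he, hm, h⟩ := nonempty_iso_image_iff.mp image
    refine nonempty_iso_image_iff.mpr ⟨Q ◁ e, Q ◁ m, (ModuleCat.epi_iff_surjective _).mpr ?_,
      (ModuleCat.mono_iff_injective _).mpr ?_, ?_⟩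
    · exact lTensor_surjective Q ((ModuleCat.epi_iff_surjective e).mp he)
    · exact Module.Flat.lTensor_preserves_injective_linearMap _
        ((ModuleCat.mono_iff_injective m).mp hm)
    · exact (whiskerLeft_comp Q e m).symm.trans congr(Q ◁ $h)

namespace IsSemidualizing

variable (hC : IsSemidualizing C)
include hC

theorem isDCProjectiveModule_of_projective {M : ModuleCat.{u} R} (hM : projectiveModules R M) :
    IsDCProjectiveModule C M := by
  have : Module.Projective R M := hM
  let e := LinearEquiv.ofBijective (lsmul R C : R →ₗ[R] C →ₗ[R] C) hC.bijective_homothety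
  exact (hC.isDCProjectiveModule_end.tensorLeft M).of_iso
    (e.symm.lTensor M ≪≫ₗ TensorProduct.rid R M).toModuleIso

theorem isDCProjectiveModule_of_cProjective {M : ModuleCat.{u} R} (hM : cProjectiveModules C M) :
    IsDCProjectiveModule C M := by
  obtain ⟨P, hP, ⟨e⟩⟩ := hM
  exact (hC.isDCProjectiveModule_self.tensorLeft P).of_iso
    (TensorProduct.comm R P C ≪≫ₗ e.symm).toModuleIso

end IsSemidualizing

end Module

section Disks

open Limits

variable {𝒜 : Type*} [Category* 𝒜] [Abelian 𝒜]

/-- The short exact sequence `0 ⟶ Z_{j+1}(X) ⟶ X_{j+1} ⟶ Z_j(X) ⟶ 0` of an acyclic complex `X`. -/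
noncomputable abbrev cyclesShortComplex (X : ChainComplex 𝒜 ℤ) (j : ℤ) : ShortComplex 𝒜 :=
  .mk (X.iCycles (j + 1)) (X.toCycles (j + 1) j) (by simp [← cancel_mono (X.iCycles j)])

theorem shortExact_cyclesShortComplex {X : ChainComplex 𝒜 ℤ} (hX : X.Acyclic) (j : ℤ) :
    (cyclesShortComplex X j).ShortExact where
  exact := by
    refine ShortComplex.exact_of_f_is_kernel _ (KernelFork.IsLimit.ofι _ _
      (fun k hk => X.liftCycles k j (by simp) ?_) (fun _ _ => X.liftCycles_i _ _ _ _)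
      fun k hk b hb => ?_)
    · rw [← X.toCycles_i (j + 1) j, reassoc_of% hk, zero_comp]
    · rw [← cancel_mono (X.iCycles (j + 1)), X.liftCycles_i, hb]
  mono_f := inferInstanceAs (Mono (X.iCycles (j + 1)))
  epi_g := by
    have h : Epi (X.toCycles _ j) := (hX j).epi_toCycles
    rwa [ChainComplex.prev] at h

theorem shortExact_biprod_inl_snd (A B : 𝒜) :
    (ShortComplex.mk (biprod.inl : A ⟶ A ⊞ B) biprod.snd (by simp)).ShortExact :=
  (ShortComplex.Splitting.ofHasBinaryBiproduct A B).shortExact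

theorem exact_biprod_map {S T : ShortComplex 𝒜} (hS : S.Exact) (hT : T.Exact) :
    (ShortComplex.mk (biprod.map S.f T.f) (biprod.map S.g T.g) (by ext <;> simp)).Exact := by
  refine (ShortComplex.exact_iff_exact_up_to_refinements _).mpr fun A x hx => ?_
  obtain ⟨A₁, π₁, _, y₁, h₁⟩ := hS.exact_up_to_refinements (x ≫ biprod.fst)
    (by simpa using hx =≫ biprod.fst)
  obtain ⟨A₂, π₂, _, y₂, h₂⟩ := hT.exact_up_to_refinements (π₁ ≫ x ≫ biprod.snd)
    (by simpa using π₁ ≫= hx =≫ biprod.snd)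
  refine ⟨A₂, π₂ ≫ π₁, inferInstance, biprod.lift (π₂ ≫ y₁) y₂, ?_⟩
  dsimp
  ext <;> simp [h₁, h₂]

/-- The direct sum over `n` of the disk complexes `M n ⟶ M n` in degrees `n` and `n - 1`. -/
noncomputable abbrev disks (M : ℤ → 𝒜) : ChainComplex 𝒜 ℤ :=
  .of (fun n => M (n + 1) ⊞ M n) (fun _ => biprod.snd ≫ biprod.inl) (by simp)

namespace disks

variable {M N L : ℤ → 𝒜}

theorem d_eq (M : ℤ → 𝒜) (n : ℤ) : (disks M).d (n + 1) n = biprod.snd ≫ biprod.inl := by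
  simp

variable {X : ChainComplex 𝒜 ℤ}

/-- The morphism out of a sum of disks with prescribed values in the top degree of each disk. -/
noncomputable def desc (φ : ∀ n, M n ⟶ X.X n) : disks M ⟶ X where
  f n := biprod.desc (φ (n + 1) ≫ X.d (n + 1) n) (φ n)
  comm' := by
    rintro _ n rfl
    rw [d_eq]
    ext <;> simp

@[simp]
theorem inr_desc (φ : ∀ n, M n ⟶ X.X n) (n : ℤ) : biprod.inr ≫ (desc φ).f n = φ n :=
  biprod.inr_desc _ _

theorem hom_ext {f g : disks M ⟶ X} (h : ∀ n, biprod.inr ≫ f.f n = biprod.inr ≫ g.f n) :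
    f = g := by
  ext n : 1
  refine biprod.hom_ext' _ _ ?_ (h n)
  have inl_eq : biprod.inl = biprod.inr ≫ (disks M).d (n + 1) n := by simp
  rw [inl_eq, Category.assoc, Category.assoc, ← f.comm, ← g.comm, reassoc_of% (h (n + 1))]

/-- Functoriality of `disks`. -/
noncomputable def map (α : ∀ n, M n ⟶ N n) : disks M ⟶ disks N where
  f n := biprod.map (α (n + 1)) (α n)
  comm' := by
    rintro _ n rfl
    rw [d_eq, d_eq]
    simp

@[simp]
theorem map_f (α : ∀ n, M n ⟶ N n) (n : ℤ) : (map α).f n = biprod.map (α (n + 1)) (α n) := rfl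

theorem map_comp_map (α : ∀ n, M n ⟶ N n) (β : ∀ n, N n ⟶ L n) :
    map α ≫ map β = map fun n => α n ≫ β n :=
  hom_ext fun n => by simp

theorem map_zero : map (0 : ∀ n, M n ⟶ N n) = 0 :=
  hom_ext fun n => by simp

theorem epi_map (α : ∀ n, M n ⟶ N n) [∀ n, Epi (α n)] : Epi (map α) :=
  have (n : ℤ) : Epi ((map α).f n) := inferInstanceAs (Epi (biprod.map (α (n + 1)) (α n)))
  HomologicalComplex.epi_of_epi_f _ this

theorem mono_map (α : ∀ n, M n ⟶ N n) [∀ n, Mono (α n)] : Mono (map α) :=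
  have (n : ℤ) : Mono ((map α).f n) := inferInstanceAs (Mono (biprod.map (α (n + 1)) (α n)))
  HomologicalComplex.mono_of_mono_f _ this

theorem exact_inl_d (M : ℤ → 𝒜) (n : ℤ) :
    (ShortComplex.mk (biprod.inl : _ ⟶ (disks M).X (n + 1)) ((disks M).d (n + 1) n)
      (by simp)).Exact := by
  simpa only [ChainComplex.of_d] using
    exact_comp_of_mono (shortExact_biprod_inl_snd (M (n + 1 + 1)) _).exact biprod.inl

theorem acyclic (M : ℤ → 𝒜) : (disks M).Acyclic := by
  refine (acyclic_iff_exact_sc' _).mpr fun n => ?_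
  have exact := exact_comp_of_epi (biprod.snd : (disks M).X (n + 1 + 1) ⟶ _) (exact_inl_d M n)
  simpa only [HomologicalComplex.sc', HomologicalComplex.shortComplexFunctor', ChainComplex.of_d]
    using exact

/-- The cycles of `disks M` in degree `n` are `M (n + 1)`. -/
noncomputable def cyclesIso (M : ℤ → 𝒜) (n : ℤ) : (disks M).cycles (n + 1) ≅ M (n + 1 + 1) :=
  IsLimit.conePointUniqueUpToIso ((disks M).cyclesIsKernel (n + 1) n (by simp))
    (exact_inl_d M n).fIsKernel

theorem isIso_desc (hX : X.Acyclic) {s : ∀ n, M n ⟶ X.X n}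
    (hs : ∀ n, IsIso (s (n + 1) ≫ X.toCycles (n + 1) n)) : IsIso (desc s) := by
  have (i : ℤ) : IsIso ((desc s).f i) := by
    obtain ⟨n, rfl⟩ : ∃ n, i = n + 1 := ⟨i - 1, by lia⟩
    let φ : ShortComplex.mk biprod.inl biprod.snd biprod.inl_snd ⟶ cyclesShortComplex X n :=
      { τ₁ := s (n + 1 + 1) ≫ X.toCycles (n + 1 + 1) (n + 1)
        τ₂ := (desc s).f (n + 1)
        τ₃ := s (n + 1) ≫ X.toCycles (n + 1) n
        comm₁₂ := by simp [desc]
        comm₂₃ := by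
          dsimp [desc]
          ext <;> simp }
    have : IsIso φ.τ₁ := hs (n + 1)
    have : IsIso φ.τ₃ := hs n
    exact ShortComplex.isIso₂_of_shortExact_of_isIso₁₃ φ (shortExact_biprod_inl_snd _ _)
      (shortExact_cyclesShortComplex hX n)
  exact HomologicalComplex.Hom.isIso_of_components _

/-- The short complex obtained by applying `disks` to a family of short complexes. -/
noncomputable abbrev mapShortComplex (S : ℤ → ShortComplex 𝒜) :
    ShortComplex (ChainComplex 𝒜 ℤ) :=
  .mk (map fun n => (S n).f) (map fun n => (S n).g) (by
    rw [map_comp_map, ← map_zero]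
    exact congrArg map (funext fun n => (S n).zero))

theorem homExact_mapShortComplex {S : ℤ → ShortComplex 𝒜} {H : ChainComplex 𝒜 ℤ}
    (h : ∀ n, HomExact (S n) (H.X n)) : HomExact (mapShortComplex S) H := by
  intro u hu
  choose v hv using fun n => h n (biprod.inr ≫ u.f n) (by
    simpa using congr(biprod.inr ≫ HomologicalComplex.Hom.f $hu n))
  refine ⟨desc v, hom_ext (M := fun n => (S n).X₂) fun n => ?_⟩
  rw [HomologicalComplex.comp_f, map_f, biprod.inr_map_assoc]
  exact ((S n).g ≫= inr_desc v n).trans (hv n)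

theorem exact_mapShortComplex {S : ℤ → ShortComplex 𝒜} (h : ∀ n, (S n).Exact) :
    (mapShortComplex S).Exact := by
  exact HomologicalComplex.exact_of_degreewise_exact _ fun n => exact_biprod_map (h (n + 1)) (h n)

/-- The complex of complexes obtained by applying `disks` to a family of complexes. -/
noncomputable def mapComplex (T : ℤ → ChainComplex 𝒜 ℤ) : ChainComplex (ChainComplex 𝒜 ℤ) ℤ where
  X i := disks fun n => (T n).X i
  d i j := map fun n => (T n).d i j
  shape i j h := by
    rw [← map_zero]
    exact congrArg map (funext fun n => (T n).shape i j h)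
  d_comp_d' i j k _ _ := (mapShortComplex fun n => (T n).sc' i j k).zero

theorem nonempty_iso (hX : X.Acyclic)
    (split : ∀ j, ∃ s : X.cycles j ⟶ X.X (j + 1), s ≫ X.toCycles (j + 1) j = 𝟙 _) :
    Nonempty (disks (fun n => X.cycles (n - 1)) ≅ X) := by
  have split' (n : ℤ) : ∃ s : X.cycles (n - 1) ⟶ X.X n, s ≫ X.toCycles n (n - 1) = 𝟙 _ := by
    obtain ⟨j, rfl⟩ : ∃ j, n = j + 1 := ⟨n - 1, by lia⟩
    rw [add_sub_cancel_right]
    exact split j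
  choose s hs using split'
  have (n j : ℤ) (hj : n - 1 = j) : IsIso (s n ≫ X.toCycles n j) := by
    subst hj
    rw [hs]
    infer_instance
  have := isIso_desc hX fun n => this (n + 1) n (by lia)
  exact ⟨asIso (desc s)⟩

end disks

end Disks

section ModuleComplexes

variable {R : Type u} [CommRing R] {C : ModuleCat.{u} R}

theorem complexesOf_disks {𝒳 : ObjectProperty (ModuleCat.{u} R)} [𝒳.IsClosedUnderIsomorphisms]
    {M : ℤ → ModuleCat.{u} R} (hM : ∀ n, 𝒳 (M n)) : complexesOf 𝒳 (disks M) := by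
  refine ⟨disks.acyclic M, fun i => ?_⟩
  obtain ⟨n, rfl⟩ : ∃ n, i = n + 1 := ⟨i - 1, by lia⟩
  exact 𝒳.prop_of_iso (disks.cyclesIso M n).symm (hM _)

namespace IsSemidualizing

variable (hC : IsSemidualizing C)
include hC

theorem exists_lift_of_projective_or_cProjective {S : ShortComplex (ModuleCat.{u} R)}
    (hS : S.ShortExact) (h₁ : cFlatModules C S.X₁) {A : ModuleCat.{u} R}
    (hA : projectiveModules R A ∨ cProjectiveModules C A) (u : A ⟶ S.X₃) :
    ∃ v, v ≫ S.g = u := by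
  obtain hA | hA := hA
  · have : Projective A := (IsProjective.iff_projective _).mp hA
    have := hS.epi_g
    exact ⟨Projective.factorThru u S.g, Projective.factorThru_comp u S.g⟩
  · exact hC.exists_lift_of_cProjective hS h₁ hA u

theorem homExact_X_of_complexesOf_cFlat {T : ShortComplex (ModuleCat.{u} R)}
    (hT : ∀ B, cFlatModules C B → HomExact T B)
    (hT₃ : projectiveModules R T.X₃ ∨ cProjectiveModules C T.X₃)
    {H : ChainComplex (ModuleCat.{u} R) ℤ} (hH : complexesOf (cFlatModules C) H) (n : ℤ) :
    HomExact T (H.X n) := by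
  obtain ⟨j, rfl⟩ : ∃ j, n = j + 1 := ⟨n - 1, by lia⟩
  have hS := shortExact_cyclesShortComplex hH.1 j
  exact HomExact.of_shortExact hS (hT _ (hH.2 _)) (hT _ (hH.2 _))
    (hC.exists_lift_of_projective_or_cProjective hS (hH.2 _) hT₃)

theorem isDCProjective_disks {M : ℤ → ModuleCat.{u} R} (hM : ∀ n, IsDCProjectiveModule C (M n)) :
    IsDCProjective C (disks M) := by
  choose T acyclic homExact hP hQ image using hM
  refine ⟨disks.mapComplex T, (acyclic_iff_exact_sc' _).mpr fun j => ?_,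
    isHomExact_iff.mpr fun H hH j => ?_, fun i hi => complexesOf_disks fun n => hP n i hi,
    fun i hi => complexesOf_disks fun n => hQ n i hi, nonempty_iso_image_iff.mpr ?_⟩
  · exact disks.exact_mapShortComplex fun n => (acyclic_iff_exact_sc' _).mp (acyclic n) j
  · have hT₃ (n : ℤ) : projectiveModules R ((T n).X j) ∨ cProjectiveModules C ((T n).X j) :=
      (le_or_gt 0 j).imp (hP n j) (hQ n j)
    exact disks.homExact_mapShortComplex (S := fun n => (T n).sc' (j + 1 + 1) (j + 1) j) fun n =>
      hC.homExact_X_of_complexesOf_cFlat (fun B hB => isHomExact_iff.mp (homExact n) B hB j)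
        (hT₃ n) hH n
  · choose e m _ _ hem using fun n => nonempty_iso_image_iff.mp (image n)
    exact ⟨disks.map e, disks.map m, disks.epi_map e, disks.mono_map m,
      (disks.map_comp_map e m).trans congr(disks.map $(funext hem))⟩

theorem isDCProjective_of_split {X : ChainComplex (ModuleCat.{u} R) ℤ} (hX : X.Acyclic)
    (hcycles : ∀ i, IsDCProjectiveModule C (X.cycles i))
    (split : ∀ j, ∃ s : X.cycles j ⟶ X.X (j + 1), s ≫ X.toCycles (j + 1) j = 𝟙 _) :
    IsDCProjective C X := by
  obtain ⟨e⟩ := disks.nonempty_iso hX split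
  exact HasCompleteResolution.of_iso (hC.isDCProjective_disks fun n => hcycles (n - 1)) e

end IsSemidualizing

end ModuleComplexes

theorem corollary2p9 {R : Type u} [CommRing R] (C : ModuleCat.{u} R) (hC : IsSemidualizing C)
    (X : ChainComplex (ModuleCat.{u} R) ℤ) :
    (complexesOf (projectiveModules R) X → IsDCProjective C X) ∧
      (complexesOf (cProjectiveModules C) X → IsDCProjective C X) := by
  refine ⟨fun ⟨acyclic, hZ⟩ => ?_, fun ⟨acyclic, hZ⟩ => ?_⟩
  · refine hC.isDCProjective_of_split acyclic
      (fun i => hC.isDCProjectiveModule_of_projective (hZ i)) fun j => ?_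
    have : Projective (X.cycles j) := (IsProjective.iff_projective _).mp (hZ j)
    have := (shortExact_cyclesShortComplex acyclic j).epi_g
    exact ⟨Projective.factorThru (𝟙 _) (X.toCycles (j + 1) j), Projective.factorThru_comp _ _⟩
  · refine hC.isDCProjective_of_split acyclic
      (fun i => hC.isDCProjectiveModule_of_cProjective (hZ i)) fun j => ?_
    exact hC.exists_lift_of_cProjective (shortExact_cyclesShortComplex acyclic j)
      (cProjectiveModules_le_cFlatModules _ (hZ (j + 1))) (hZ j) (𝟙 _)
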